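/- Let $V$ be a $d$-dimensional complex Hilbert space and let $H=\sum_{i=1}^d E_i\,|i\rangle\langle i|$ be a non-degenerate Hamiltonian on $V$, where $(|i\rangle)_{i=1}^d$ is an orthonormal basis and $E_1<\dots<E_d$. An operator is called passive if it has the form $\sum_i x_i|i\rangle\langle i|$ with $x_1\ge\dots\ge x_d$ real. For a self-adjoint operator $X$ with eigenvalues $x_1\ge\dots\ge x_d$ (with multiplicity) put $X^\downarrow=\sum_i x_i|i\rangle\langle i|$. A state is a positive semidefinite operator of trace one. For states $\sigma,\rho$ with eigenvalues $q_1\ge\dots\ge q_d$ and $p_1\ge\dots\ge p_d$ we write $\sigma\prec\rho$ if $\sum_{i\le n}q_i\le\sum_{i\le n}p_i$ for $n=1,\dots,d$. Let $H_{LS}$ be self-adjoint with $[H_{LS},H]=0$, let $L_1,\dots,L_m$ be finitely many operators, each of one of the two forms $$L_\alpha=\sum_{i=1}^{d}a_i^\alpha\,|i\rangle\langle i|\qquad\text{or}\qquad L_\alpha=\sum_{i=1}^{d-1}b_i^\alpha\,|i\rangle\langle i+1|\qquad(a_i^\alpha,b_i^\alpha\in\mathbb C),$$ and let $$\mathcal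 L(\rho)=-i[H_{LS},\rho]+\sum_{\alpha=1}^{m}\Big(L_\alpha\rho L_\alpha^\dagger-\tfrac12\{L_\alpha^\dagger L_\alpha,\rho\}\Big).$$ Put $r_i=\sum_\alpha|b_i^\alpha|^2$ for $1\le i\le d-1$, where $b_i^\alpha=0$ if $L_\alpha$ is of the first form, and $r_0=r_d=0$. Then $\mathcal L(\mathbb I)$ is passive if and only if $r$ is concave, i.e. $r_{i-1}+r_{i+1}\le 2r_i$ for $1\le i\le d-1$. Suppose that $r$ is concave. Then: 1. For every state $\rho$ and every $t\ge0$, $e^{t\mathcal L}(\rho)$ and $e^{t\mathcal L}(\rho^\downarrow)$ are states and $e^{t\mathcal L}(\rho)\prec e^{t\mathcal L}(\rho^\downarrow)$; moreover, for every unitary $U$, $e^{t\mathcal L}(U\rho U^\dagger)$ is a state and $e^{t\mathcal L}(U\rho U^\dagger)\prec e^{t\mathcal L}(\rho^\downarrow)$. 2. For every passive state $\rho$ and every $t\ge0$, $e^{t\mathcal L}(\rho)$ is a passive state. -/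

import Mathlib

namespace LossyChannel

noncomputable section

variable {V : Type*} [NormedAddCommGroup V] [InnerProductSpace ℂ V] {d : ℕ}

/-- `∑ i, x i |i⟩⟨i|`: the operator that is diagonal in the orthonormal basis `e`. -/
def diagOp (e : OrthonormalBasis (Fin d) ℂ V) (x : Fin d → ℂ) : V →L[ℂ] V :=
  ∑ i, x i • InnerProductSpace.rankOne ℂ (e i) (e i)

/-- `∑ i, b i |i⟩⟨i+1|`, the sum being over the `d - 1` pairs of consecutive basis vectors. -/
def lowerOp (e : OrthonormalBasis (Fin d) ℂ V) (b : Fin (d - 1) → ℂ) : V →L[ℂ] V :=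
  ∑ i : Fin (d - 1), b i • InnerProductSpace.rankOne ℂ
    (e ⟨i.val, by omega⟩) (e ⟨i.val + 1, by omega⟩)

/-- A Lindblad operator that dephases in the energy basis `e`. -/
def IsDephasing (e : OrthonormalBasis (Fin d) ℂ V) (A : V →L[ℂ] V) : Prop :=
  ∃ a : Fin d → ℂ, A = diagOp e a

/-- A Lindblad operator that lowers the energy by exactly one level. -/
def IsOneStepDecay (e : OrthonormalBasis (Fin d) ℂ V) (A : V →L[ℂ] V) : Prop :=
  ∃ b : Fin (d - 1) → ℂ, A = lowerOp e b

/-- Passive operators: diagonal in the energy basis `e` (ordered by increasing energy), with real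
eigenvalues that do not increase with the energy. -/
def IsPassive (e : OrthonormalBasis (Fin d) ℂ V) (X : V →L[ℂ] V) : Prop :=
  ∃ x : Fin d → ℝ, Antitone x ∧ X = diagOp e (fun i => (x i : ℂ))

/-- Quantum states: positive semidefinite operators of trace one. -/
structure IsState (ρ : V →L[ℂ] V) : Prop where
  isPositive : ρ.IsPositive
  trace_eq_one : LinearMap.trace ℂ V (ρ : V →ₗ[ℂ] V) = 1

theorem finrank_eq (e : OrthonormalBasis (Fin d) ℂ V) : Module.finrank ℂ V = d := by
  rw [Module.finrank_eq_card_basis e.toBasis, Fintype.card_fin]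

/-- The passive rearrangement `∑ i, x i |i⟩⟨i|` of a self-adjoint operator `X` with eigenvalues
`x 0 ≥ x 1 ≥ …` (Mathlib lists them in decreasing order, with multiplicity). -/
def passiveRearrangement [FiniteDimensional ℂ V] (e : OrthonormalBasis (Fin d) ℂ V)
    (X : V →L[ℂ] V) (hX : (X : V →ₗ[ℂ] V).IsSymmetric) : V →L[ℂ] V :=
  diagOp e (fun i => (hX.eigenvalues (finrank_eq e) i : ℂ))

/-- `σ ≺ ρ` for quantum states: for each `n`, the sum of the `n` largest eigenvalues of `σ` is at
most the sum of the `n` largest eigenvalues of `ρ`. -/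
def IsMajorizedBy [FiniteDimensional ℂ V] (σ ρ : V →L[ℂ] V) : Prop :=
  ∃ (hσ : IsState σ) (hρ : IsState ρ), ∀ n : ℕ, n ≤ Module.finrank ℂ V →
    ∑ i : Fin (Module.finrank ℂ V) with i.val < n, hσ.isPositive.isSymmetric.eigenvalues rfl i ≤
      ∑ i : Fin (Module.finrank ℂ V) with i.val < n, hρ.isPositive.isSymmetric.eigenvalues rfl i

/-- The generator
`ρ ↦ -i [HLS, ρ] + ∑ α, (L α ρ (L α)† - (1/2) {(L α)† L α, ρ})`. -/
def lindbladian [FiniteDimensional ℂ V] [CompleteSpace V] {m : ℕ} (HLS : V →L[ℂ] V)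
    (L : Fin m → V →L[ℂ] V) : (V →L[ℂ] V) →L[ℂ] (V →L[ℂ] V) :=
  LinearMap.toContinuousLinearMap
    { toFun := fun ρ => -Complex.I • (HLS * ρ - ρ * HLS) +
        ∑ α, (L α * ρ * star (L α) -
          (1 / 2 : ℂ) • (star (L α) * L α * ρ + ρ * (star (L α) * L α)))
      map_add' := by
        intro ρ σ
        rw [add_add_add_comm, ← Finset.sum_add_distrib, ← smul_add]
        congr 1
        · congr 1; noncomm_ring
        · refine Finset.sum_congr rfl fun α _ => ?_
          rw [sub_add_sub_comm, ← smul_add]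
          congr 1
          · noncomm_ring
          · congr 1; noncomm_ring
      map_smul' := by
        intro c ρ
        rw [RingHom.id_apply, smul_add, Finset.smul_sum]
        congr 1
        · rw [mul_smul_comm, smul_mul_assoc, ← smul_sub, smul_comm]
        · refine Finset.sum_congr rfl fun α _ => ?_
          simp only [mul_smul_comm, smul_mul_assoc, smul_sub, smul_add, smul_comm c] }

/-- The exponential `e^{tℒ}` of a bounded operator `ℒ` on a normed space `W`; it is used with `W`
the space of operators on `V`. -/
def evolution {W : Type*} [NormedAddCommGroup W] [NormedSpace ℂ W] (ℒ : W →L[ℂ] W) (t : ℝ) :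
    W →L[ℂ] W :=
  NormedSpace.exp ((t : ℂ) • ℒ)

/-- `r i = ∑ α, |b_i^α|²` for `i = 0, …, d`, where, with energy levels numbered `1, …, d`,
`b_i^α = ⟨i| L α |i+1⟩` for `1 ≤ i ≤ d - 1` and `b_0^α = b_d^α = 0`. The index of `e` starts at `0`,
so level `i` is `e (i - 1)`. Dephasing operators contribute zero. -/
def jumpRate {m : ℕ} (e : OrthonormalBasis (Fin d) ℂ V) (L : Fin m → V →L[ℂ] V) (i : ℕ) : ℝ :=
  if h : 1 ≤ i ∧ i < d then
    ∑ α, ‖inner ℂ (e ⟨i - 1, by omega⟩) (L α (e ⟨i, h.2⟩))‖ ^ 2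
  else 0

/-- Concavity of a sequence on `{0, …, d}`. -/
def ConcaveUpTo (d : ℕ) (r : ℕ → ℝ) : Prop :=
  ∀ i : ℕ, i + 2 ≤ d → r i + r (i + 2) ≤ 2 * r (i + 1)

end

end LossyChannel

/-!
Write `ℒ` for the generator and `r` for the sequence of jump rates.

*The generator as a Markov generator.* If `σ` is diagonal in an orthonormal basis `v`, with
eigenvalues `x`, then `⟨v j| ℒ σ |v j⟩ = ∑ k, (x k * a j k - x j * a k j)` with the transition rates
`a j k = ∑ α, |⟨v j| L α |v k⟩|²` (`inner_lindbladian_diagOp_self`). In the energy basis only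
transitions by one level down occur, at the rates `r`, and `ℒ` maps diagonal operators to diagonal
ones. In particular `ℒ 1` is diagonal with entries `r (i + 1) - r i`, and is passive exactly when
`r` is concave.

*Growth of the largest eigenvalues.* Let `x` be the decreasing eigenvalues of `σ ≥ 0` and `v` an
eigenbasis. In the rate of change of the weight on `v 0, …, v (n - 1)`, transitions among these
vectors cancel, and the remaining flow is at most what it would be for `x n • 1`
(`sum_markov_le`). The latter is `x n` times the weight of the passive operator `ℒ 1` on `n`
orthonormal vectors, which by Ky Fan's inequality is at most `r n`. So the rate is at most
`r n * x n` (`sum_inner_lindbladian_le`), with equality if `σ` is passive and `v` is the energy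
basis. The partial sums `S n` of the eigenvalues thus satisfy
`S n' ≤ r n * (S (n + 1) - S n)`, with equality along passive states, and this system is monotone.

*Avoiding derivatives of eigenvalues.* Since `exp (t ℒ)` is the limit of `(1 - (t/N) ℒ)⁻ᴺ`, a closed
relation is preserved by the evolution as soon as it passes from right-hand sides to solutions of
`σ - h ℒ σ = ρ` for small `h` (`evolution_rel_of_resolvent`). For the relation "`σ` and `σ'` are
states, `σ'` is passive and `σ ≺ σ'`" (`passiveDomination`) this only involves the eigenbasis of the
solution `σ`, so the estimate above applies to it directly (`passiveDomination_of_resolvent`). Both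
statements about the evolution are instances: the pair of `U ρ U†` and the passive rearrangement of
`ρ`, and the pair of a passive state with itself.
-/

namespace LossyChannel

/-! ### Implicit Euler steps -/

section Euler

open Filter Topology

theorem norm_pow_sub_pow_le {A : Type*} [NormedRing A] (h1 : ‖(1 : A)‖ ≤ 1) {a b : A} {M : ℝ}
    (hM : 1 ≤ M) (ha : ‖a‖ ≤ M) (hb : ‖b‖ ≤ M) (n : ℕ) :
    ‖a ^ n - b ^ n‖ ≤ n * M ^ n * ‖a - b‖ := by
  have hM0 : 0 ≤ M := zero_le_one.trans hM
  have hpow : ∀ k : ℕ, ‖b ^ k‖ ≤ M ^ k := by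
    intro k
    induction k with
    | zero => simpa using h1
    | succ k ih =>
      rw [pow_succ, pow_succ]
      exact (norm_mul_le _ _).trans (by gcongr)
  induction n with
  | zero => simp
  | succ n ih =>
    have h : a ^ (n + 1) - b ^ (n + 1) = a * (a ^ n - b ^ n) + (a - b) * b ^ n := by
      rw [pow_succ', pow_succ']; noncomm_ring
    rw [h]
    have h2 : ‖(a - b) * b ^ n‖ ≤ M ^ (n + 1) * ‖a - b‖ := by
      refine (norm_mul_le _ _).trans ?_
      rw [mul_comm]
      gcongr
      exact (hpow n).trans (pow_le_pow_right₀ hM n.le_succ)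
    have h3 : ‖a * (a ^ n - b ^ n)‖ ≤ M * (n * M ^ n * ‖a - b‖) :=
      (norm_mul_le _ _).trans (by gcongr)
    refine (norm_add_le _ _).trans ((add_le_add h3 h2).trans_eq ?_)
    push_cast
    ring

variable {A : Type*} [NormedRing A] [NormedAlgebra ℂ A]

theorem norm_exp_le_exp_norm (h1 : ‖(1 : A)‖ ≤ 1) (x : A) :
    ‖NormedSpace.exp x‖ ≤ Real.exp ‖x‖ := by
  have hr : HasSum (fun n : ℕ => (n.factorial : ℝ)⁻¹ * ‖x‖ ^ n) (Real.exp ‖x‖) := by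
    have := NormedSpace.exp_series_hasSum_exp' (𝕂 := ℝ) ‖x‖
    rw [← Real.exp_eq_exp_ℝ] at this
    simpa using this
  rw [NormedSpace.exp_eq_tsum ℂ]
  refine tsum_of_norm_bounded hr fun n => ?_
  rw [norm_smul, norm_inv, Complex.norm_natCast]
  gcongr
  induction n with
  | zero => simpa using h1
  | succ k ih =>
    rw [pow_succ, pow_succ]
    exact (norm_mul_le _ _).trans (by gcongr)

theorem tendsto_one_add_smul_pow_exp [CompleteSpace A] (h1 : ‖(1 : A)‖ ≤ 1) (x : A) :
    Tendsto (fun N : ℕ => (1 + ((N : ℂ)⁻¹) • x) ^ N) atTop (𝓝 (NormedSpace.exp x)) := by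
  have hlit : (fun y : A => NormedSpace.exp y - 1 - y) =o[𝓝 0] fun y => y := by
    have := (hasFDerivAt_exp_zero (𝕂 := ℂ) (𝔸 := A)).isLittleO
    simpa using this
  have hlim : Tendsto (fun N : ℕ => ((N : ℂ)⁻¹) • x) atTop (𝓝 0) := by
    have : Tendsto (fun N : ℕ => ((N : ℂ)⁻¹)) atTop (𝓝 0) := tendsto_inv_atTop_nhds_zero_nat
    simpa using this.smul_const x
  rw [tendsto_iff_norm_sub_tendsto_zero]
  rw [Metric.tendsto_atTop]
  intro ε hε
  set C := Real.exp ‖x‖ * (‖x‖ + 1) with hC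
  have hCpos : 0 < C := by positivity
  have hev := hlim.eventually (hlit.bound (half_pos (div_pos hε hCpos)))
  obtain ⟨N₀, hN₀⟩ := (hev.and (eventually_gt_atTop 0)).exists_forall_of_atTop
  refine ⟨N₀, fun N hN => ?_⟩
  obtain ⟨hb, hpos⟩ := hN₀ N hN
  have hNR : (0 : ℝ) < N := by exact_mod_cast hpos
  have hNC : (N : ℂ) ≠ 0 := by exact_mod_cast hpos.ne'
  have hnorm : ‖((N : ℂ)⁻¹) • x‖ = ‖x‖ / N := by
    rw [norm_smul, norm_inv, Complex.norm_natCast]; ring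
  have hexp : NormedSpace.exp x = NormedSpace.exp (((N : ℂ)⁻¹) • x) ^ N := by
    let := NormedAlgebra.restrictScalars ℚ ℂ A
    rw [← NormedSpace.exp_nsmul, ← Nat.cast_smul_eq_nsmul ℂ, smul_smul, mul_inv_cancel₀ hNC,
      one_smul]
  have hMN : Real.exp (‖x‖ / N) ^ N = Real.exp ‖x‖ := by
    rw [← Real.exp_nat_mul]; congr 1; field_simp
  have key := norm_pow_sub_pow_le h1 (a := 1 + ((N : ℂ)⁻¹) • x)
    (b := NormedSpace.exp (((N : ℂ)⁻¹) • x)) (M := Real.exp (‖x‖ / N))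
    (Real.one_le_exp (by positivity))
    ((norm_add_le _ _).trans (by
      rw [hnorm]; linarith [Real.add_one_le_exp (‖x‖ / N)]))
    ((norm_exp_le_exp_norm h1 _).trans_eq (by rw [hnorm])) N
  rw [← hexp, hMN] at key
  have hb' : ‖1 + ((N : ℂ)⁻¹) • x - NormedSpace.exp (((N : ℂ)⁻¹) • x)‖
      ≤ ε / C / 2 * (‖x‖ / N) := by
    rw [← hnorm, ← norm_neg]
    refine (le_of_eq ?_).trans hb
    congr 1
    abel
  rw [dist_zero_right, norm_norm]
  calc _ ≤ _ := key
    _ ≤ N * Real.exp ‖x‖ * (ε / C / 2 * (‖x‖ / N)) := by gcongr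
    _ = (ε / 2) * (Real.exp ‖x‖ * ‖x‖ / C) := by field_simp
    _ ≤ (ε / 2) * 1 := by
      gcongr
      rw [div_le_one hCpos, hC]
      gcongr
      linarith
    _ < ε := by linarith

/-- **Invariance from implicit Euler steps.** As `exp (t ℒ)` is the limit of `(1 - (t/N) ℒ)⁻ᴺ`, a
closed relation that passes from the right-hand sides `ρ`, `ρ'` to the solutions `σ`, `σ'` of
`σ - h ℒ σ = ρ`, `σ' - h ℒ σ' = ρ'` for all small `h` is preserved by the evolution. -/
theorem evolution_rel_of_resolvent {W : Type*} [NormedAddCommGroup W] [NormedSpace ℂ W]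
    [CompleteSpace W] (ℒ : W →L[ℂ] W) {K : Set (W × W)} (hK : IsClosed K) {h₀ : ℝ} (h₀pos : 0 < h₀)
    (hstep : ∀ h : ℝ, 0 ≤ h → h < h₀ → ∀ σ σ' : W,
      (σ - (h : ℂ) • ℒ σ, σ' - (h : ℂ) • ℒ σ') ∈ K → (σ, σ') ∈ K)
    {t : ℝ} (ht : 0 ≤ t) {ρ ρ' : W} (hρ : (ρ, ρ') ∈ K) :
    (evolution ℒ t ρ, evolution ℒ t ρ') ∈ K := by
  have h1 : ‖(1 : W →L[ℂ] W)‖ ≤ 1 := ContinuousLinearMap.norm_id_le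
  set x : W →L[ℂ] W := -((t : ℂ) • ℒ) with hx
  set B : ℕ → (W →L[ℂ] W) := fun N => 1 + ((N : ℂ)⁻¹) • x with hB
  have hlim := tendsto_one_add_smul_pow_exp h1 x
  let := NormedAlgebra.restrictScalars ℚ ℂ (W →L[ℂ] W)
  have hG : Tendsto (fun N : ℕ => Ring.inverse (B N) ^ N) atTop (𝓝 (evolution ℒ t)) := by
    have hu := NormedSpace.isUnit_exp x
    have := (NormedRing.inverse_continuousAt hu.unit).tendsto.comp hlim
    rw [IsUnit.unit_spec, Ring.inverse_exp, hx, neg_neg] at this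
    simp only [Ring.inverse_pow]
    exact this
  have hunit : ∀ᶠ N in atTop, IsUnit (B N) := by
    have h0 : Tendsto B atTop (𝓝 1) := by
      have : Tendsto (fun N : ℕ => ((N : ℂ)⁻¹)) atTop (𝓝 0) := tendsto_inv_atTop_nhds_zero_nat
      simpa using (this.smul_const x).const_add 1
    exact h0.eventually (Units.isOpen.mem_nhds isUnit_one)
  have hsmall : ∀ᶠ N : ℕ in atTop, t / N < h₀ :=
    (tendsto_const_div_atTop_nhds_zero_nat t).eventually (gt_mem_nhds h₀pos)
  have hmem : ∀ᶠ N in atTop, ((Ring.inverse (B N) ^ N) ρ, (Ring.inverse (B N) ^ N) ρ') ∈ K := by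
    filter_upwards [hunit, hsmall] with N hu hs
    have hsolve : ∀ y : W, Ring.inverse (B N) y -
        ((t / N : ℝ) : ℂ) • ℒ (Ring.inverse (B N) y) = y := by
      intro y
      have := congrArg (fun T : W →L[ℂ] W => T y) (Ring.mul_inverse_cancel _ hu)
      simp only [mul_apply_eq_comp, one_apply_eq_self] at this
      conv_rhs => rw [← this]
      generalize Ring.inverse (B N) y = z
      simp [hB, hx, mul_smul, div_eq_inv_mul, sub_eq_add_neg]
    have hiter : ∀ k : ℕ, ((Ring.inverse (B N) ^ k) ρ, (Ring.inverse (B N) ^ k) ρ') ∈ K := by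
      intro k
      induction k with
      | zero => simpa using hρ
      | succ k ih =>
        refine hstep (t / N) (by positivity) hs _ _ ?_
        rw [pow_succ', mul_apply_eq_comp, mul_apply_eq_comp, hsolve,
          hsolve]
        exact ih
    exact hiter N
  refine hK.mem_of_tendsto (Tendsto.prodMk_nhds ?_ ?_) hmem
  · exact ((ContinuousLinearMap.apply ℂ W ρ).continuous.tendsto _).comp hG
  · exact ((ContinuousLinearMap.apply ℂ W ρ').continuous.tendsto _).comp hG

end Euler

/-! ### Matrix entries of the generator -/

section Entries

open scoped InnerProductSpace

variable {V : Type*} [NormedAddCommGroup V] [InnerProductSpace ℂ V] {d m : ℕ}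

theorem diagOp_apply (v : OrthonormalBasis (Fin d) ℂ V) (x : Fin d → ℂ) (w : V) :
    diagOp v x w = ∑ k, (x k * ⟪v k, w⟫_ℂ) • v k := by
  simp [diagOp, sum_apply, smul_smul]

theorem diagOp_apply_self (v : OrthonormalBasis (Fin d) ℂ V) (x : Fin d → ℂ) (k : Fin d) :
    diagOp v x (v k) = x k • v k := by
  simp [diagOp_apply, v.inner_eq_ite]

theorem inner_diagOp (v : OrthonormalBasis (Fin d) ℂ V) (x : Fin d → ℂ) (k : Fin d) (w : V) :
    ⟪v k, diagOp v x w⟫_ℂ = x k * ⟪v k, w⟫_ℂ := by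
  simp [diagOp_apply, v.inner_eq_ite]

theorem inner_diagOp_right (v : OrthonormalBasis (Fin d) ℂ V) (x : Fin d → ℂ) (u w : V) :
    ⟪u, diagOp v x w⟫_ℂ = ∑ k, x k * (⟪u, v k⟫_ℂ * ⟪v k, w⟫_ℂ) := by
  simp only [diagOp_apply, inner_sum, inner_smul_right]
  exact Finset.sum_congr rfl fun k _ => by ring

theorem diagOp_one (v : OrthonormalBasis (Fin d) ℂ V) : diagOp v (fun _ => 1) = 1 := by
  ext w
  simp [diagOp_apply, v.sum_repr']

/-- An operator is determined by its matrix entries. -/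
theorem ext_inner_basis (v : OrthonormalBasis (Fin d) ℂ V) {X Y : V →L[ℂ] V}
    (h : ∀ i j, ⟪v i, X (v j)⟫_ℂ = ⟪v i, Y (v j)⟫_ℂ) : X = Y := by
  refine ContinuousLinearMap.coe_injective (v.toBasis.ext fun j => ?_)
  refine v.repr.injective (PiLp.ext fun i => ?_)
  simpa [v.repr_apply_apply] using h i j

theorem eq_diagOp_iff (v : OrthonormalBasis (Fin d) ℂ V) (X : V →L[ℂ] V) :
    X = diagOp v (fun i => ⟪v i, X (v i)⟫_ℂ) ↔ ∀ i j, i ≠ j → ⟪v i, X (v j)⟫_ℂ = 0 := by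
  constructor
  · intro h i j hij
    rw [h, inner_diagOp, v.inner_eq_zero hij, mul_zero]
  · intro h
    refine ext_inner_basis v fun i j => ?_
    rw [inner_diagOp]
    by_cases hij : i = j
    · subst hij; simp
    · rw [h i j hij, v.inner_eq_zero hij, mul_zero]

theorem isPassive_iff (v : OrthonormalBasis (Fin d) ℂ V) (X : V →L[ℂ] V) :
    IsPassive v X ↔ (∀ i j, i ≠ j → ⟪v i, X (v j)⟫_ℂ = 0) ∧ (∀ i, (⟪v i, X (v i)⟫_ℂ).im = 0) ∧
      ∀ i j, i ≤ j → (⟪v j, X (v j)⟫_ℂ).re ≤ (⟪v i, X (v i)⟫_ℂ).re := by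
  constructor
  · rintro ⟨x, hx, rfl⟩
    refine ⟨fun i j hij => ?_, fun i => ?_, fun i j hij => ?_⟩
    · rw [inner_diagOp, v.inner_eq_zero hij, mul_zero]
    · simp [inner_diagOp]
    · simpa [inner_diagOp] using hx hij
  · rintro ⟨h0, him, hre⟩
    refine ⟨fun i => (⟪v i, X (v i)⟫_ℂ).re, fun i j hij => hre i j hij, ?_⟩
    rw [(eq_diagOp_iff v X).2 h0]
    congr 1
    funext i
    refine Complex.ext ?_ ?_ <;> simp [inner_diagOp, him]

theorem exists_eq_diagOp [FiniteDimensional ℂ V] (e : OrthonormalBasis (Fin d) ℂ V)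
    (X : V →L[ℂ] V) (hX : (X : V →ₗ[ℂ] V).IsSymmetric) :
    X = diagOp (hX.eigenvectorBasis (finrank_eq e))
      (fun i => (hX.eigenvalues (finrank_eq e) i : ℂ)) := by
  refine ext_inner_basis (hX.eigenvectorBasis (finrank_eq e)) fun i j => ?_
  rw [diagOp_apply_self]
  congr 1
  exact hX.apply_eigenvectorBasis (finrank_eq e) j

/-- The rate `∑ α, |⟨v j| L α |v k⟩|²` at which the jumps carry weight from `v k` to `v j`. -/
noncomputable def transitionRate (L : Fin m → V →L[ℂ] V) (v : OrthonormalBasis (Fin d) ℂ V)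
    (j k : Fin d) : ℝ :=
  ∑ α, ‖⟪v j, L α (v k)⟫_ℂ‖ ^ 2

theorem transitionRate_nonneg (L : Fin m → V →L[ℂ] V) (v : OrthonormalBasis (Fin d) ℂ V)
    (j k : Fin d) : 0 ≤ transitionRate L v j k :=
  Finset.sum_nonneg fun _ _ => by positivity

variable [FiniteDimensional ℂ V] [CompleteSpace V]

theorem lindbladian_apply (HLS : V →L[ℂ] V) (L : Fin m → V →L[ℂ] V) (X : V →L[ℂ] V) :
    lindbladian HLS L X = -Complex.I • (HLS * X - X * HLS) +
        ∑ α, (L α * X * star (L α) -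
          (1 / 2 : ℂ) • (star (L α) * L α * X + X * (star (L α) * L α))) := rfl

theorem inner_lindbladian_diagOp (HLS : V →L[ℂ] V) (L : Fin m → V →L[ℂ] V)
    (v : OrthonormalBasis (Fin d) ℂ V) (x : Fin d → ℂ) (i j : Fin d) :
    ⟪v i, lindbladian HLS L (diagOp v x) (v j)⟫_ℂ =
      -Complex.I * ((x j - x i) * ⟪v i, HLS (v j)⟫_ℂ) +
        ∑ α, (∑ k, x k * (⟪v i, L α (v k)⟫_ℂ * ⟪L α (v k), v j⟫_ℂ) -
          (1 / 2) * ((x i + x j) * ∑ k, ⟪L α (v i), v k⟫_ℂ * ⟪v k, L α (v j)⟫_ℂ)) := by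
  have hadj : ∀ (α : Fin m) (u w : V), ⟪u, star (L α) w⟫_ℂ = ⟪L α u, w⟫_ℂ := fun α u w =>
    ContinuousLinearMap.adjoint_inner_right (L α) u w
  have hadj' : ∀ (α : Fin m) (u w : V), ⟪u, L α w⟫_ℂ = ⟪star (L α) u, w⟫_ℂ := fun α u w =>
    (ContinuousLinearMap.adjoint_inner_left (L α) w u).symm
  rw [lindbladian_apply]
  simp only [add_apply, sum_apply, sub_apply, smul_apply, mul_apply_eq_comp, inner_add_right,
    inner_sub_right, inner_smul_right, inner_sum, diagOp_apply_self, map_smul, inner_diagOp]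
  congr 1
  · ring
  · refine Finset.sum_congr rfl fun α _ => ?_
    congr 1
    · rw [hadj', inner_diagOp_right]
      simp only [← hadj', hadj]
    · simp only [hadj]
      rw [← v.sum_inner_mul_inner (L α (v i)) (L α (v j))]
      ring

/-- On the diagonal of an operator that is diagonal in `v`, the generator acts as the generator of
a classical Markov process on the basis vectors; the Hamiltonian part drops out. -/
theorem inner_lindbladian_diagOp_self (HLS : V →L[ℂ] V) (L : Fin m → V →L[ℂ] V)
    (v : OrthonormalBasis (Fin d) ℂ V) (x : Fin d → ℂ) (i : Fin d) :
    ⟪v i, lindbladian HLS L (diagOp v x) (v i)⟫_ℂ =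
      ∑ k, (x k * transitionRate L v i k - x i * transitionRate L v k i) := by
  have h1 : ∀ (α : Fin m) (j k : Fin d), ⟪v j, L α (v k)⟫_ℂ * ⟪L α (v k), v j⟫_ℂ =
      ((‖⟪v j, L α (v k)⟫_ℂ‖ ^ 2 : ℝ) : ℂ) := fun α j k => by
    rw [← inner_conj_symm (L α (v k)) (v j), Complex.mul_conj, Complex.normSq_eq_norm_sq]
  rw [inner_lindbladian_diagOp, sub_self, zero_mul, mul_zero, zero_add, Finset.sum_sub_distrib,
    Finset.sum_sub_distrib]
  simp only [transitionRate, Complex.ofReal_sum, Finset.mul_sum, mul_comm ⟪L _ (v i), v _⟫_ℂ, h1]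
  rw [Finset.sum_comm]
  congr 1
  rw [Finset.sum_comm]
  exact Finset.sum_congr rfl fun k _ => Finset.sum_congr rfl fun α _ => by ring

theorem re_inner_lindbladian_diagOp_self (HLS : V →L[ℂ] V) (L : Fin m → V →L[ℂ] V)
    (v : OrthonormalBasis (Fin d) ℂ V) (x : Fin d → ℝ) (i : Fin d) :
    (⟪v i, lindbladian HLS L (diagOp v fun k => (x k : ℂ)) (v i)⟫_ℂ).re =
      ∑ k, (x k * transitionRate L v i k - x i * transitionRate L v k i) := by
  rw [inner_lindbladian_diagOp_self]
  simp [← Complex.ofReal_mul]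

theorem trace_lindbladian (HLS : V →L[ℂ] V) (L : Fin m → V →L[ℂ] V) (X : V →L[ℂ] V) :
    LinearMap.trace ℂ V (lindbladian HLS L X : V →L[ℂ] V) = 0 := by
  have hc : ∀ S T : V →L[ℂ] V, LinearMap.trace ℂ V ((S * T : V →L[ℂ] V) : V →ₗ[ℂ] V) =
      LinearMap.trace ℂ V ((T * S : V →L[ℂ] V) : V →ₗ[ℂ] V) := fun S T =>
    LinearMap.trace_mul_comm ℂ (S : V →ₗ[ℂ] V) (T : V →ₗ[ℂ] V)
  rw [lindbladian_apply]
  simp only [ContinuousLinearMap.toLinearMap_add, ContinuousLinearMap.toLinearMap_sub,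
    ContinuousLinearMap.toLinearMap_smul, ContinuousLinearMap.toLinearMap_sum, map_add, map_sub,
    map_smul, map_sum]
  rw [hc X HLS, sub_self, smul_zero, zero_add]
  refine Finset.sum_eq_zero fun α _ => ?_
  rw [hc (L α * X), hc X, ← mul_assoc, smul_eq_mul]
  ring

theorem star_lindbladian {HLS : V →L[ℂ] V} (hHLS : IsSelfAdjoint HLS) (L : Fin m → V →L[ℂ] V)
    (X : V →L[ℂ] V) : star (lindbladian HLS L X) = lindbladian HLS L (star X) := by
  simp only [lindbladian_apply, star_add, star_sub, star_smul, star_sum, star_mul, star_star,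
    hHLS.star_eq, star_neg]
  congr 1
  · simp [smul_sub]
    abel
  · refine Finset.sum_congr rfl fun α _ => ?_
    simp [mul_assoc, add_comm]

end Entries

/-! ### Sums of the largest entries -/

section Sums

variable {d : ℕ}

theorem exists_threshold_of_antitone {x : Fin d → ℝ} (hx : Antitone x) (n : ℕ) :
    ∃ c, (∀ k : Fin d, k.val < n → c ≤ x k) ∧ ∀ k : Fin d, n ≤ k.val → x k ≤ c := by
  by_cases hn : n < d
  · exact ⟨x ⟨n, hn⟩, fun k hk => hx (Fin.le_def.2 hk.le), fun k hk => hx (Fin.le_def.2 hk)⟩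
  · refine ⟨-∑ k, |x k|, fun k _ => ?_, fun k hk => absurd k.2 (by omega)⟩
    have := Finset.single_le_sum (f := fun k => |x k|) (fun i _ => abs_nonneg _)
      (Finset.mem_univ k)
    linarith [neg_abs_le (x k)]

/-- Averaging with a doubly stochastic matrix does not increase the sum of the `n` largest
entries. -/
theorem sum_mul_le_of_doublyStochastic {x : Fin d → ℝ} (hx : Antitone x)
    {w : Fin d → Fin d → ℝ} (h0 : ∀ j k, 0 ≤ w j k) (hrow : ∀ j, ∑ k, w j k = 1)
    (hcol : ∀ k, ∑ j, w j k = 1) (n : ℕ) :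
    ∑ j : Fin d with j.val < n, ∑ k, x k * w j k ≤ ∑ k : Fin d with k.val < n, x k := by
  obtain ⟨c, hc1, hc2⟩ := exists_threshold_of_antitone hx n
  have hleft : ∑ j : Fin d with j.val < n, ∑ k, x k * w j k =
      ∑ k, (x k - c) * (∑ j : Fin d with j.val < n, w j k) +
        ∑ j : Fin d with j.val < n, c := by
    simp only [Finset.mul_sum]
    rw [Finset.sum_comm (s := Finset.univ), ← Finset.sum_add_distrib]
    refine Finset.sum_congr rfl fun j _ => ?_
    have : ∑ k, (x k - c) * w j k = ∑ k, x k * w j k - c * ∑ k, w j k := by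
      rw [Finset.mul_sum, ← Finset.sum_sub_distrib]
      exact Finset.sum_congr rfl fun k _ => by ring
    rw [this, hrow]
    ring
  have hright : ∑ k : Fin d with k.val < n, x k =
      ∑ k : Fin d, (if k.val < n then x k - c else 0) + ∑ j : Fin d with j.val < n, c := by
    rw [← Finset.sum_filter, ← Finset.sum_add_distrib]
    exact Finset.sum_congr rfl fun k _ => by ring
  rw [hleft, hright]
  refine add_le_add_left (Finset.sum_le_sum fun k _ => ?_) _
  have hW0 : 0 ≤ ∑ j : Fin d with j.val < n, w j k := Finset.sum_nonneg fun j _ => h0 j k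
  have hW1 : ∑ j : Fin d with j.val < n, w j k ≤ 1 := by
    rw [← hcol k]
    exact Finset.sum_le_sum_of_subset_of_nonneg (Finset.filter_subset _ _) fun j _ _ => h0 j k
  split_ifs with hk
  · exact mul_le_of_le_one_right (sub_nonneg.2 (hc1 k hk)) hW1
  · exact mul_nonpos_of_nonpos_of_nonneg (sub_nonpos.2 (hc2 k (not_lt.1 hk))) hW0

/-- For a Markov process with transition rates `a`, the growth rate of the total weight `x` of a
set `S` whose elements all have weight at least `c`, while the weights outside are at most `c`, is
at most what it would be if every weight were equal to `c`: transitions inside `S` cancel, and the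
inflow decreases and the outflow increases with the deviations from `c`. -/
theorem sum_markov_le {ι : Type*} [Fintype ι] [DecidableEq ι] {a : ι → ι → ℝ}
    (ha : ∀ j k, 0 ≤ a j k) {x : ι → ℝ} {c : ℝ} (S : Finset ι) (hS : ∀ k ∈ S, c ≤ x k)
    (hS' : ∀ k ∉ S, x k ≤ c) :
    ∑ j ∈ S, ∑ k, (x k * a j k - x j * a k j) ≤ c * ∑ j ∈ S, ∑ k, (a j k - a k j) := by
  rw [← sub_nonpos]
  have hsplit : ∑ j ∈ S, ∑ k, (x k * a j k - x j * a k j) - c * ∑ j ∈ S, ∑ k, (a j k - a k j) =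
      ∑ j ∈ S, ∑ k ∈ S, ((x k - c) * a j k - (x j - c) * a k j) +
        ∑ j ∈ S, ∑ k ∈ Sᶜ, ((x k - c) * a j k - (x j - c) * a k j) := by
    rw [Finset.mul_sum, ← Finset.sum_sub_distrib, ← Finset.sum_add_distrib]
    refine Finset.sum_congr rfl fun j _ => ?_
    rw [Finset.sum_add_sum_compl, Finset.mul_sum, ← Finset.sum_sub_distrib]
    exact Finset.sum_congr rfl fun k _ => by ring
  have hcancel : ∑ j ∈ S, ∑ k ∈ S, ((x k - c) * a j k - (x j - c) * a k j) = 0 := by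
    simp only [Finset.sum_sub_distrib]
    rw [Finset.sum_comm, sub_self]
  rw [hsplit, hcancel, zero_add]
  refine Finset.sum_nonpos fun j hj => Finset.sum_nonpos fun k hk => ?_
  have h1 := mul_nonpos_of_nonpos_of_nonneg (sub_nonpos.2 (hS' k (Finset.mem_compl.1 hk))) (ha j k)
  have h2 := mul_nonneg (sub_nonneg.2 (hS j hj)) (ha k j)
  linarith

end Sums

section KyFan

open scoped InnerProductSpace

variable {V : Type*} [NormedAddCommGroup V] [InnerProductSpace ℂ V] {d : ℕ}

/-- **Ky Fan's inequality.** -/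
theorem sum_inner_diagOp_le (u v : OrthonormalBasis (Fin d) ℂ V) {x : Fin d → ℝ} (hx : Antitone x)
    (n : ℕ) :
    ∑ j : Fin d with j.val < n, (⟪u j, diagOp v (fun k => (x k : ℂ)) (u j)⟫_ℂ).re ≤
      ∑ k : Fin d with k.val < n, x k := by
  refine le_of_eq_of_le ?_ (sum_mul_le_of_doublyStochastic hx
    (w := fun j k => ‖⟪u j, v k⟫_ℂ‖ ^ 2) (fun j k => by positivity)
    (fun j => by rw [v.sum_sq_norm_inner_left, u.norm_eq_one]; norm_num)
    (fun k => by rw [u.sum_sq_norm_inner_right, v.norm_eq_one]; norm_num) n)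
  refine Finset.sum_congr rfl fun j _ => ?_
  rw [inner_diagOp_right, Complex.re_sum]
  refine Finset.sum_congr rfl fun k _ => ?_
  rw [← inner_conj_symm (v k) (u j), Complex.mul_conj, Complex.normSq_eq_norm_sq,
    ← Complex.ofReal_mul, Complex.ofReal_re]

end KyFan

/-! ### The generator on diagonal operators -/

section Ladder

open scoped InnerProductSpace

variable {V : Type*} [NormedAddCommGroup V] [InnerProductSpace ℂ V] {d m : ℕ}
  {e : OrthonormalBasis (Fin d) ℂ V} {L : Fin m → V →L[ℂ] V}

/-- All nonzero matrix entries of a jump operator lie on one diagonal. This is why it maps diagonal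
operators to diagonal ones. -/
theorem exists_shift {A : V →L[ℂ] V} (hA : IsDephasing e A ∨ IsOneStepDecay e A) :
    ∃ s : ℕ, s ≤ 1 ∧ ∀ i k : Fin d, ⟪e i, A (e k)⟫_ℂ ≠ 0 → i.val + s = k.val := by
  rcases hA with ⟨a, rfl⟩ | ⟨b, rfl⟩
  · refine ⟨0, zero_le_one, fun i k h => ?_⟩
    by_contra hik
    refine h ?_
    rw [inner_diagOp, e.inner_eq_zero (fun h' => hik (by simp [h'])), mul_zero]
  · refine ⟨1, le_rfl, fun i k h => ?_⟩
    by_contra hik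
    refine h ?_
    simp only [lowerOp, sum_apply, smul_apply, InnerProductSpace.rankOne_apply, inner_sum,
      inner_smul_right, e.inner_eq_ite]
    refine Finset.sum_eq_zero fun l _ => ?_
    split_ifs with h1 h2
    · exfalso
      subst h1 h2
      exact hik rfl
    all_goals simp

theorem transitionRate_eq_zero (hL : ∀ α, IsDephasing e (L α) ∨ IsOneStepDecay e (L α))
    {j k : Fin d} (h1 : k ≠ j) (h2 : k.val ≠ j.val + 1) : transitionRate L e j k = 0 := by
  refine Finset.sum_eq_zero fun α _ => ?_
  obtain ⟨s, hs, h⟩ := exists_shift (hL α)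
  by_contra hne
  have := h j k (fun h0 => hne (by simp [h0]))
  have : j.val ≠ k.val := fun h => h1 (Fin.ext h.symm)
  omega

theorem jumpRate_zero : jumpRate e L 0 = 0 := by simp [jumpRate]

theorem jumpRate_of_le {i : ℕ} (h : d ≤ i) : jumpRate e L i = 0 := by
  simp [jumpRate, show ¬ i < d by omega]

theorem jumpRate_nonneg (i : ℕ) : 0 ≤ jumpRate e L i := by
  unfold jumpRate
  split_ifs
  · exact Finset.sum_nonneg fun _ _ => by positivity
  · exact le_rfl

theorem jumpRate_eq_transitionRate {j k : Fin d} (h : k.val = j.val + 1) :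
    jumpRate e L k.val = transitionRate L e j k := by
  have h2 : 1 ≤ k.val ∧ k.val < d := ⟨by omega, k.2⟩
  rw [jumpRate, dif_pos h2, transitionRate]
  have : (⟨k.val - 1, by omega⟩ : Fin d) = j := Fin.ext (by simp [h])
  simp only [this]

/-- In the energy basis the populations follow a pure death process: level `i` gains at rate
`r (i + 1)` from the level above it and loses at rate `r i`. -/
theorem sum_transitionRate (hL : ∀ α, IsDephasing e (L α) ∨ IsOneStepDecay e (L α)) (x : ℕ → ℝ)
    (i : Fin d) :
    ∑ k : Fin d, (x k * transitionRate L e i k - x i * transitionRate L e k i) =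
      jumpRate e L (i + 1) * x (i + 1) - jumpRate e L i * x i := by
  have hin : ∀ k : Fin d, x k * transitionRate L e i k =
      (if k = i then x i * transitionRate L e i i else 0) +
        if k.val = i.val + 1 then jumpRate e L (i + 1) * x (i + 1) else 0 := by
    intro k
    by_cases h1 : k = i
    · subst h1; simp
    · by_cases h2 : k.val = i.val + 1
      · rw [if_neg h1, if_pos h2, ← h2, jumpRate_eq_transitionRate h2]; ring
      · rw [if_neg h1, if_neg h2, transitionRate_eq_zero hL h1 h2]; ring
  have hout : ∀ k : Fin d, x i * transitionRate L e k i =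
      (if k = i then x i * transitionRate L e i i else 0) +
        if i.val = k.val + 1 then jumpRate e L i * x i else 0 := by
    intro k
    by_cases h1 : k = i
    · subst h1; simp
    · by_cases h2 : i.val = k.val + 1
      · rw [if_neg h1, if_pos h2, jumpRate_eq_transitionRate h2]; ring
      · rw [if_neg h1, if_neg h2, transitionRate_eq_zero hL (Ne.symm h1) h2]; ring
  have hin' : ∑ k : Fin d, (if k.val = i.val + 1 then jumpRate e L (i + 1) * x (i + 1) else 0) =
      jumpRate e L (i + 1) * x (i + 1) := by
    by_cases h : i.val + 1 < d
    · rw [Finset.sum_eq_single ⟨i.val + 1, h⟩ (fun k _ hk => if_neg fun h' => hk (Fin.ext h'))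
        (by simp)]
      simp
    · simp [jumpRate_of_le (e := e) (L := L) (not_lt.1 h)]
  have hout' : ∑ k : Fin d, (if i.val = k.val + 1 then jumpRate e L i * x i else 0) =
      jumpRate e L i * x i := by
    by_cases h : i.val = 0
    · simp [h, jumpRate_zero]
    · rw [Finset.sum_eq_single ⟨i.val - 1, by omega⟩
        (fun k _ hk => if_neg fun h' => hk (Fin.ext (by simp [h']))) (by simp)]
      rw [if_pos (by simp; omega)]
  rw [Finset.sum_sub_distrib, Finset.sum_congr rfl fun k _ => hin k,
    Finset.sum_congr rfl fun k _ => hout k, Finset.sum_add_distrib, Finset.sum_add_distrib, hin',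
    hout']
  ring

theorem sum_filter_val_lt {n : ℕ} (hn : n ≤ d) (f : ℕ → ℝ) :
    ∑ i : Fin d with i.val < n, f i = ∑ i ∈ Finset.range n, f i := by
  rw [Finset.sum_filter, Fin.sum_univ_eq_sum_range (fun i => if i < n then f i else 0) d,
    ← Finset.sum_filter]
  congr 1
  ext i
  simp only [Finset.mem_filter, Finset.mem_range]
  omega

theorem sum_jumpRate_sub {n : ℕ} (x : ℕ → ℝ) :
    ∑ i ∈ Finset.range n, (jumpRate e L (i + 1) * x (i + 1) - jumpRate e L i * x i) =
      jumpRate e L n * x n := by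
  rw [Finset.sum_range_sub (fun i => jumpRate e L i * x i), jumpRate_zero, zero_mul, sub_zero]

theorem inner_eq_zero_of_commute {E : Fin d → ℝ} (hE : StrictMono E) {H HLS : V →L[ℂ] V}
    (hH : ∀ i, H (e i) = (E i : ℂ) • e i) (hcomm : Commute HLS H) {i j : Fin d} (hij : i ≠ j) :
    ⟪e i, HLS (e j)⟫_ℂ = 0 := by
  have hHd : H = diagOp e (fun k => (E k : ℂ)) :=
    ext_inner_basis e fun k l => by rw [hH, diagOp_apply_self]
  have h := congrArg (fun T : V →L[ℂ] V => ⟪e i, T (e j)⟫_ℂ) hcomm.eq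
  simp only [mul_apply_eq_comp, hHd, inner_diagOp, diagOp_apply_self, map_smul,
    inner_smul_right] at h
  have hne : (E j : ℂ) - E i ≠ 0 := by
    rw [sub_ne_zero]
    exact_mod_cast fun h => hij (hE.injective h).symm
  have h0 : ((E j : ℂ) - E i) * ⟪e i, HLS (e j)⟫_ℂ = 0 := by rw [sub_mul, h, sub_self]
  exact (mul_eq_zero.1 h0).resolve_left hne

theorem antitone_jumpRate_sub_iff :
    Antitone (fun i : Fin d => jumpRate e L (i + 1) - jumpRate e L i) ↔
      ConcaveUpTo d (jumpRate e L) := by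
  constructor
  · intro h i hi
    have := h (a := ⟨i, by omega⟩) (b := ⟨i + 1, by omega⟩) (Fin.le_def.2 (by simp))
    simp only at this
    rw [show i + 1 + 1 = i + 2 from rfl] at this
    linarith
  · intro h
    cases d with
    | zero => exact fun i => i.elim0
    | succ d =>
      refine Fin.antitone_iff_succ_le.2 fun i => ?_
      have := h i.val (by omega)
      simp only [Fin.val_succ, Fin.val_castSucc]
      rw [show i.val + 1 + 1 = i.val + 2 from rfl]
      linarith

variable [FiniteDimensional ℂ V] [CompleteSpace V] {HLS : V →L[ℂ] V}

theorem inner_lindbladian_diagOp_of_ne (hdiag : ∀ i j, i ≠ j → ⟪e i, HLS (e j)⟫_ℂ = 0)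
    (hL : ∀ α, IsDephasing e (L α) ∨ IsOneStepDecay e (L α)) (x : Fin d → ℂ) {i j : Fin d}
    (hij : i ≠ j) : ⟪e i, lindbladian HLS L (diagOp e x) (e j)⟫_ℂ = 0 := by
  rw [inner_lindbladian_diagOp, hdiag i j hij, mul_zero, mul_zero, zero_add]
  refine Finset.sum_eq_zero fun α _ => ?_
  obtain ⟨s, -, hs⟩ := exists_shift (hL α)
  have h1 : ∀ k, ⟪e i, L α (e k)⟫_ℂ * ⟪L α (e k), e j⟫_ℂ = 0 := by
    intro k
    by_contra hne
    have h1 := hs i k (left_ne_zero_of_mul hne)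
    have h2 := hs j k (fun h => right_ne_zero_of_mul hne (inner_eq_zero_symm.1 h))
    exact hij (Fin.ext (by omega))
  have h2 : ∀ k, ⟪L α (e i), e k⟫_ℂ * ⟪e k, L α (e j)⟫_ℂ = 0 := by
    intro k
    by_contra hne
    have h1 := hs k j (right_ne_zero_of_mul hne)
    have h2 := hs k i (fun h => left_ne_zero_of_mul hne (inner_eq_zero_symm.1 h))
    exact hij (Fin.ext (by omega))
  simp [h1, h2]

theorem inner_lindbladian_diagOp_self_energy
    (hL : ∀ α, IsDephasing e (L α) ∨ IsOneStepDecay e (L α)) (x : ℕ → ℝ) (i : Fin d) :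
    ⟪e i, lindbladian HLS L (diagOp e fun k => (x k : ℂ)) (e i)⟫_ℂ =
      ((jumpRate e L (i + 1) * x (i + 1) - jumpRate e L i * x i : ℝ) : ℂ) := by
  rw [inner_lindbladian_diagOp_self, ← sum_transitionRate hL]
  push_cast
  rfl

theorem lindbladian_diagOp (hdiag : ∀ i j, i ≠ j → ⟪e i, HLS (e j)⟫_ℂ = 0)
    (hL : ∀ α, IsDephasing e (L α) ∨ IsOneStepDecay e (L α)) (x : ℕ → ℝ) :
    lindbladian HLS L (diagOp e fun k => (x k : ℂ)) = diagOp e fun i =>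
      ((jumpRate e L (i + 1) * x (i + 1) - jumpRate e L i * x i : ℝ) : ℂ) := by
  rw [(eq_diagOp_iff e _).2 fun i j hij => inner_lindbladian_diagOp_of_ne hdiag hL _ hij]
  simp only [inner_lindbladian_diagOp_self_energy hL]

theorem lindbladian_one (hdiag : ∀ i j, i ≠ j → ⟪e i, HLS (e j)⟫_ℂ = 0)
    (hL : ∀ α, IsDephasing e (L α) ∨ IsOneStepDecay e (L α)) :
    lindbladian HLS L 1 = diagOp e fun i =>
      ((jumpRate e L (i + 1) - jumpRate e L i : ℝ) : ℂ) := by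
  rw [← diagOp_one e]
  simpa using lindbladian_diagOp hdiag hL fun _ => 1

theorem isPassive_lindbladian_one_iff (hdiag : ∀ i j, i ≠ j → ⟪e i, HLS (e j)⟫_ℂ = 0)
    (hL : ∀ α, IsDephasing e (L α) ∨ IsOneStepDecay e (L α)) :
    IsPassive e (lindbladian HLS L 1) ↔ ConcaveUpTo d (jumpRate e L) := by
  rw [lindbladian_one hdiag hL, ← antitone_jumpRate_sub_iff]
  refine ⟨?_, fun h => ⟨_, h, rfl⟩⟩
  rintro ⟨x, hx, h⟩
  convert hx using 1
  funext i
  have := congrArg (fun T : V →L[ℂ] V => ⟪e i, T (e i)⟫_ℂ) h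
  simp only [inner_diagOp, e.inner_eq_one, mul_one] at this
  exact_mod_cast this

end Ladder

/-! ### One implicit Euler step -/

section RealStep

variable {d : ℕ} {r : ℕ → ℝ} {h : ℝ}

/-- A finite sequence extended by zero. -/
theorem exists_extend_zero (x : Fin d → ℝ) :
    ∃ y : ℕ → ℝ, (∀ i : Fin d, y i = x i) ∧ ∀ k, d ≤ k → y k = 0 :=
  ⟨fun k => if hk : k < d then x ⟨k, hk⟩ else 0, fun i => by simp, fun k hk => by
    simp [not_lt.2 hk]⟩

/-- Induction from the highest level downwards: concavity of `r` makes the gap `y i - y (i + 1)`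
nonnegative as soon as the gap above it and `y (i + 1)` are. -/
theorem le_of_implicit_step_antitone (hh : 0 ≤ h) (hr : ∀ i, 0 ≤ r i) (hconc : ConcaveUpTo d r)
    {y : ℕ → ℝ} (hy : ∀ i, 0 ≤ y i) (hyd : ∀ k, d ≤ k → y k = 0)
    (hx : ∀ i, i + 1 < d → y (i + 1) - h * (r (i + 2) * y (i + 2) - r (i + 1) * y (i + 1)) ≤
      y i - h * (r (i + 1) * y (i + 1) - r i * y i)) :
    ∀ i, y (i + 1) ≤ y i := by
  have key : ∀ k i, i + k + 1 = d → y (i + 1) ≤ y i := by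
    intro k
    induction k with
    | zero => intro i hi; rw [hyd (i + 1) (by omega)]; exact hy i
    | succ k ih =>
      intro i hi
      have h1 : y (i + 2) ≤ y (i + 1) := ih (i + 1) (by omega)
      have h2 := hx i (by omega)
      have h3 : 0 ≤ h * ((2 * r (i + 1) - r i - r (i + 2)) * y (i + 1)) :=
        mul_nonneg hh (mul_nonneg (by linarith [hconc i (by omega)]) (hy _))
      have h4 : 0 ≤ h * (r (i + 2) * (y (i + 1) - y (i + 2))) :=
        mul_nonneg hh (mul_nonneg (hr _) (sub_nonneg.2 h1))
      have h5 : 0 ≤ (1 + h * r i) * (y i - y (i + 1)) := by linarith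
      have h6 : 0 < 1 + h * r i := by linarith [mul_nonneg hh (hr i)]
      exact sub_nonneg.1 (nonneg_of_mul_nonneg_right h5 h6)
  intro i
  by_cases hi : i < d
  · exact key (d - 1 - i) i (by omega)
  · rw [hyd i (by omega), hyd (i + 1) (by omega)]

/-- The implicit Euler step of `S n' = r n * (S (n + 1) - S n)` is monotone in the partial sums. -/
theorem sum_range_le_of_implicit_step (hh : 0 ≤ h) (hr : ∀ i, 0 ≤ r i) (hrd : r d = 0)
    {x y : ℕ → ℝ}
    (hxy : ∀ n, n ≤ d → ∑ i ∈ Finset.range n, x i - h * (r n * x n) ≤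
      ∑ i ∈ Finset.range n, y i - h * (r n * y n)) :
    ∀ n, n ≤ d → ∑ i ∈ Finset.range n, x i ≤ ∑ i ∈ Finset.range n, y i := by
  have key : ∀ k n, n + k = d → ∑ i ∈ Finset.range n, x i ≤ ∑ i ∈ Finset.range n, y i := by
    intro k
    induction k with
    | zero =>
      intro n hn
      have := hxy n (by omega)
      rw [show n = d by omega] at this ⊢
      simpa [hrd] using this
    | succ k ih =>
      intro n hn
      have h1 := ih (n + 1) (by omega)
      have h2 := hxy n (by omega)
      have h0 : 0 ≤ h * r n := mul_nonneg hh (hr n)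
      have h3 := mul_le_mul_of_nonneg_left h1 h0
      rw [Finset.sum_range_succ, Finset.sum_range_succ] at h3
      have h5 : (1 + h * r n) * ∑ i ∈ Finset.range n, x i ≤
          (1 + h * r n) * ∑ i ∈ Finset.range n, y i := by linarith
      exact le_of_mul_le_mul_left h5 (by linarith)
  intro n hn
  exact key (d - n) n (by omega)

end RealStep

section OperatorStep

open scoped InnerProductSpace

variable {V : Type*} [NormedAddCommGroup V] [InnerProductSpace ℂ V] {d m : ℕ}

theorem isPositive_diagOp (v : OrthonormalBasis (Fin d) ℂ V) {x : Fin d → ℝ} (hx : ∀ i, 0 ≤ x i) :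
    (diagOp v fun i => (x i : ℂ)).IsPositive :=
  ContinuousLinearMap.isPositive_sum _ fun i _ =>
    (InnerProductSpace.isPositive_rankOne_self (v i)).smul_of_nonneg (Complex.zero_le_real.2 (hx i))

theorem trace_diagOp [FiniteDimensional ℂ V] (v : OrthonormalBasis (Fin d) ℂ V) (x : Fin d → ℂ) :
    LinearMap.trace ℂ V (diagOp v x : V →L[ℂ] V) = ∑ i, x i := by
  rw [LinearMap.trace_eq_sum_inner _ v]
  simp [inner_diagOp]

theorem isClosed_setOf_isPassive (e : OrthonormalBasis (Fin d) ℂ V) :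
    IsClosed {X : V →L[ℂ] V | IsPassive e X} := by
  simp only [isPassive_iff, Set.ofPred_and, Set.ofPred_forall]
  refine IsClosed.inter ?_ (IsClosed.inter ?_ ?_)
  · exact isClosed_iInter fun i => isClosed_iInter fun j => isClosed_iInter fun _ =>
      isClosed_eq (by fun_prop) continuous_const
  · exact isClosed_iInter fun i => isClosed_eq (by fun_prop) continuous_const
  · exact isClosed_iInter fun i => isClosed_iInter fun j => isClosed_iInter fun _ =>
      isClosed_le (by fun_prop) (by fun_prop)

variable [CompleteSpace V]

theorem isClosed_setOf_isState (e : OrthonormalBasis (Fin d) ℂ V) :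
    IsClosed {X : V →L[ℂ] V | IsState X} := by
  have : {X : V →L[ℂ] V | IsState X} = {X | IsSelfAdjoint X} ∩
      (⋂ w : V, {X | 0 ≤ (⟪X w, w⟫_ℂ).re}) ∩ {X | ∑ i, ⟪e i, X (e i)⟫_ℂ = 1} := by
    ext X
    have htr : LinearMap.trace ℂ V (X : V →ₗ[ℂ] V) = ∑ i, ⟪e i, X (e i)⟫_ℂ := by
      rw [LinearMap.trace_eq_sum_inner _ e]; rfl
    simp only [Set.mem_inter_iff, Set.mem_ofPred_eq, Set.mem_iInter]
    rw [← htr]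
    constructor
    · intro h
      exact ⟨ContinuousLinearMap.isPositive_def'.1 h.1, h.2⟩
    · rintro ⟨h1, h2⟩
      exact ⟨ContinuousLinearMap.isPositive_def'.2 h1, h2⟩
  rw [this]
  refine ((isClosed_eq continuous_star continuous_id).inter (isClosed_iInter fun w => ?_)).inter ?_
  · exact isClosed_le continuous_const (by fun_prop)
  · exact isClosed_eq (by fun_prop) continuous_const

theorem sum_transitionRate_le (L : Fin m → V →L[ℂ] V) (v : OrthonormalBasis (Fin d) ℂ V) (j : Fin d) :
    ∑ k, transitionRate L v j k ≤ ∑ α, ‖L α‖ ^ 2 := by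
  unfold transitionRate
  rw [Finset.sum_comm]
  refine Finset.sum_le_sum fun α _ => ?_
  have h1 : ∀ k, ‖⟪v j, L α (v k)⟫_ℂ‖ ^ 2 = ‖⟪star (L α) (v j), v k⟫_ℂ‖ ^ 2 := fun k => by
    rw [ContinuousLinearMap.star_eq_adjoint, ContinuousLinearMap.adjoint_inner_left]
  simp only [h1]
  rw [v.sum_sq_norm_inner_left]
  gcongr
  refine ((star (L α)).le_opNorm _).trans_eq ?_
  rw [v.norm_eq_one, mul_one, norm_star]

/-- States `σ` and `σ'`, with `σ'` passive, such that for each `n` the weight of `σ` on any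
`n` orthonormal vectors is at most the weight of `σ'` on its `n` lowest levels. The maximum of the
former is the sum of the `n` largest eigenvalues of `σ`, so this is `σ ≺ σ'`; in this form it is
visibly a closed relation. -/
def passiveDomination (e : OrthonormalBasis (Fin d) ℂ V) : Set ((V →L[ℂ] V) × (V →L[ℂ] V)) :=
  {p | (IsState p.1 ∧ IsState p.2) ∧ IsPassive e p.2 ∧
    ∀ (u : OrthonormalBasis (Fin d) ℂ V) (n : ℕ), n ≤ d →
      ∑ j : Fin d with j.val < n, (⟪u j, p.1 (u j)⟫_ℂ).re ≤
        ∑ j : Fin d with j.val < n, (⟪e j, p.2 (e j)⟫_ℂ).re}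

theorem isClosed_passiveDomination (e : OrthonormalBasis (Fin d) ℂ V) :
    IsClosed (passiveDomination e) := by
  refine IsClosed.inter (IsClosed.inter ?_ ?_) (IsClosed.inter ?_ ?_)
  · exact (isClosed_setOf_isState e).preimage continuous_fst
  · exact (isClosed_setOf_isState e).preimage continuous_snd
  · exact (isClosed_setOf_isPassive e).preimage continuous_snd
  · change IsClosed {p : (V →L[ℂ] V) × (V →L[ℂ] V) |
      ∀ (u : OrthonormalBasis (Fin d) ℂ V) (n : ℕ), n ≤ d →
        ∑ j : Fin d with j.val < n, (⟪u j, p.1 (u j)⟫_ℂ).re ≤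
          ∑ j : Fin d with j.val < n, (⟪e j, p.2 (e j)⟫_ℂ).re}
    simp only [Set.ofPred_forall]
    refine isClosed_iInter fun u => isClosed_iInter fun n => isClosed_iInter fun _ =>
      isClosed_le ?_ ?_
    · refine continuous_finsetSum _ fun j _ => ?_
      fun_prop
    · refine continuous_finsetSum _ fun j _ => ?_
      fun_prop

variable [FiniteDimensional ℂ V] {e : OrthonormalBasis (Fin d) ℂ V} {HLS : V →L[ℂ] V}
  {L : Fin m → V →L[ℂ] V} {h : ℝ}

theorem eq_zero_of_resolvent {W : Type*} [NormedAddCommGroup W] [NormedSpace ℂ W] {ℒ : W →L[ℂ] W}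
    (hh : 0 ≤ h) (hsmall : h * ‖ℒ‖ < 1) {X : W} (hX : X - (h : ℂ) • ℒ X = 0) : X = 0 := by
  have h1 : ‖X‖ ≤ h * ‖ℒ‖ * ‖X‖ := by
    conv_lhs => rw [sub_eq_zero.1 hX]
    rw [norm_smul, Complex.norm_real, Real.norm_of_nonneg hh, mul_assoc]
    gcongr
    exact ℒ.le_opNorm X
  by_contra hne
  have := norm_pos_iff.2 hne
  nlinarith

theorem isSelfAdjoint_of_resolvent (hHLS : IsSelfAdjoint HLS) (hh : 0 ≤ h)
    (hsmall : h * ‖lindbladian HLS L‖ < 1) {σ : V →L[ℂ] V}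
    (hρ : IsSelfAdjoint (σ - (h : ℂ) • lindbladian HLS L σ)) : IsSelfAdjoint σ := by
  have hstar := hρ.star_eq
  rw [star_sub, star_smul, star_lindbladian hHLS] at hstar
  refine sub_eq_zero.1 (eq_zero_of_resolvent (ℒ := lindbladian HLS L) hh hsmall ?_)
  have : star (h : ℂ) = h := Complex.conj_ofReal h
  rw [this] at hstar
  rw [map_sub, smul_sub, sub_sub_sub_comm, hstar, sub_self]

theorem re_inner_resolvent (v : OrthonormalBasis (Fin d) ℂ V) (x : Fin d → ℝ) (j : Fin d) :
    (⟪v j, (diagOp v (fun k => (x k : ℂ)) -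
        (h : ℂ) • lindbladian HLS L (diagOp v fun k => (x k : ℂ))) (v j)⟫_ℂ).re =
      x j - h * ∑ k, (x k * transitionRate L v j k - x j * transitionRate L v k j) := by
  rw [sub_apply, smul_apply, inner_sub_right, inner_smul_right, Complex.sub_re,
    Complex.re_ofReal_mul, re_inner_lindbladian_diagOp_self, inner_diagOp, v.inner_eq_one, mul_one,
    Complex.ofReal_re]

/-- Suppose that the smallest eigenvalue `x j` of `σ` is negative, with eigenvector `v j`. As `x j`
is minimal and negative, `⟨v j| ℒ σ |v j⟩ ≥ x j * ∑ k, a j k` for the transition rates `a`, and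
`h * ∑ k, a j k < 1`; so the right-hand side has the negative expectation value
`x j - h ⟨v j| ℒ σ |v j⟩` in `v j`. -/
theorem isPositive_of_resolvent (e : OrthonormalBasis (Fin d) ℂ V) (hHLS : IsSelfAdjoint HLS)
    (hh : 0 ≤ h) (hsmall : h * ‖lindbladian HLS L‖ < 1) (hsmall' : h * ∑ α, ‖L α‖ ^ 2 < 1)
    {σ : V →L[ℂ] V} (hρ : (σ - (h : ℂ) • lindbladian HLS L σ).IsPositive) : σ.IsPositive := by
  have hsa : IsSelfAdjoint σ := isSelfAdjoint_of_resolvent hHLS hh hsmall hρ.isSelfAdjoint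
  have hσ := hsa.isSymmetric
  obtain ⟨v, x, rfl⟩ : ∃ (v : OrthonormalBasis (Fin d) ℂ V) (x : Fin d → ℝ),
      σ = diagOp v fun i => (x i : ℂ) := ⟨_, _, exists_eq_diagOp e σ hσ⟩
  refine isPositive_diagOp v fun i => ?_
  obtain ⟨j, -, hj⟩ := Finset.exists_min_image Finset.univ x ⟨i, Finset.mem_univ i⟩
  refine le_trans ?_ (hj i (Finset.mem_univ i))
  by_contra hneg
  rw [not_le] at hneg
  have h0 := hρ.re_inner_nonneg_right (v j)
  have h1 := re_inner_resolvent (HLS := HLS) (L := L) (h := h) v x j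
  have h2 : x j * ∑ k, transitionRate L v j k ≤
      ∑ k, (x k * transitionRate L v j k - x j * transitionRate L v k j) := by
    rw [Finset.mul_sum]
    refine Finset.sum_le_sum fun k _ => ?_
    have h3 := mul_le_mul_of_nonneg_right (hj k (Finset.mem_univ k))
      (transitionRate_nonneg L v j k)
    have h4 := mul_nonpos_of_nonpos_of_nonneg hneg.le (transitionRate_nonneg L v k j)
    linarith
  have h5 : h * ∑ k, transitionRate L v j k < 1 :=
    (mul_le_mul_of_nonneg_left (sum_transitionRate_le L v j) hh).trans_lt hsmall'
  have h6 := mul_le_mul_of_nonneg_left h2 hh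
  have h7 : 0 ≤ x j * (1 - h * ∑ k, transitionRate L v j k) := by
    have : 0 ≤ x j - h * ∑ k, (x k * transitionRate L v j k - x j * transitionRate L v k j) := by
      rw [← h1]; exact h0
    linarith
  exact absurd h7 (not_le.2 (mul_neg_of_neg_of_pos hneg (by linarith)))

theorem isState_of_resolvent (e : OrthonormalBasis (Fin d) ℂ V) (hHLS : IsSelfAdjoint HLS)
    (hh : 0 ≤ h) (hsmall : h * ‖lindbladian HLS L‖ < 1) (hsmall' : h * ∑ α, ‖L α‖ ^ 2 < 1)
    {σ : V →L[ℂ] V} (hρ : IsState (σ - (h : ℂ) • lindbladian HLS L σ)) : IsState σ := by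
  refine ⟨isPositive_of_resolvent e hHLS hh hsmall hsmall' hρ.1, ?_⟩
  have := hρ.2
  rwa [ContinuousLinearMap.toLinearMap_sub, ContinuousLinearMap.toLinearMap_smul, map_sub,
    map_smul, trace_lindbladian, smul_zero, sub_zero] at this

/-- The diagonal operators are an invariant subspace of the injective map `1 - h ℒ`, hence its
restriction to them is onto. -/
theorem inner_eq_zero_of_resolvent (hdiag : ∀ i j, i ≠ j → ⟪e i, HLS (e j)⟫_ℂ = 0)
    (hL : ∀ α, IsDephasing e (L α) ∨ IsOneStepDecay e (L α))
    (hh : 0 ≤ h) (hsmall : h * ‖lindbladian HLS L‖ < 1) {σ : V →L[ℂ] V}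
    (hρ : ∀ i j, i ≠ j → ⟪e i, (σ - (h : ℂ) • lindbladian HLS L σ) (e j)⟫_ℂ = 0) {i j : Fin d}
    (hij : i ≠ j) : ⟪e i, σ (e j)⟫_ℂ = 0 := by
  let D : Submodule ℂ (V →L[ℂ] V) :=
    { carrier := {X | ∀ i j, i ≠ j → ⟪e i, X (e j)⟫_ℂ = 0}
      add_mem' := fun {X Y} hX hY i j hij => by
        simp [add_apply, hX i j hij, hY i j hij]
      zero_mem' := fun i j _ => by simp
      smul_mem' := fun c X hX i j hij => by
        simp [smul_apply, hX i j hij] }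
  let T : (V →L[ℂ] V) →ₗ[ℂ] (V →L[ℂ] V) :=
    LinearMap.id - (h : ℂ) • (lindbladian HLS L : (V →L[ℂ] V) →ₗ[ℂ] (V →L[ℂ] V))
  have hTinj : ∀ X, T X = 0 → X = 0 := fun X hX => eq_zero_of_resolvent hh hsmall hX
  have hTD : ∀ X ∈ D, T X ∈ D := by
    intro X hX
    refine D.sub_mem hX (D.smul_mem _ fun i j hij => ?_)
    rw [(eq_diagOp_iff e X).2 hX]
    exact inner_lindbladian_diagOp_of_ne hdiag hL _ hij
  have hinj : Function.Injective (T.restrict hTD) := by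
    rw [injective_iff_map_eq_zero]
    intro X hX
    exact Subtype.ext (hTinj X (congrArg Subtype.val hX))
  obtain ⟨Y, hY⟩ := LinearMap.injective_iff_surjective.1 hinj ⟨T σ, hρ⟩
  have hYσ : T (Y : V →L[ℂ] V) = T σ := congrArg Subtype.val hY
  have : (Y : V →L[ℂ] V) = σ := sub_eq_zero.1 (hTinj _ (by rw [map_sub, hYσ, sub_self]))
  rw [← this]
  exact Y.2 i j hij

end OperatorStep

/-! ### Domination by a passive state -/

section Domination

open scoped InnerProductSpace

variable {V : Type*} [NormedAddCommGroup V] [InnerProductSpace ℂ V] {d m : ℕ}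
  {e : OrthonormalBasis (Fin d) ℂ V}

theorem self_mem_passiveDomination {ρ : V →L[ℂ] V} (hρ : IsState ρ) (hp : IsPassive e ρ) :
    (ρ, ρ) ∈ passiveDomination e := by
  refine ⟨⟨hρ, hρ⟩, hp, fun u n _ => ?_⟩
  obtain ⟨x, hx, rfl⟩ := hp
  refine (sum_inner_diagOp_le u e hx n).trans_eq (Finset.sum_congr rfl fun j _ => ?_)
  rw [inner_diagOp, e.inner_eq_one, mul_one, Complex.ofReal_re]

theorem isState_conj_unitary [CompleteSpace V] {ρ : V →L[ℂ] V} (hρ : IsState ρ) {U : V →L[ℂ] V}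
    (hU : U ∈ unitary (V →L[ℂ] V)) : IsState (U * ρ * star U) := by
  refine ⟨hρ.1.conj_adjoint U, ?_⟩
  have hc := LinearMap.trace_mul_comm ℂ ((U * ρ : V →L[ℂ] V) : V →ₗ[ℂ] V)
    ((star U : V →L[ℂ] V) : V →ₗ[ℂ] V)
  have hU' : star U * (U * ρ) = ρ := by rw [← mul_assoc, (Unitary.mem_iff.1 hU).1, one_mul]
  refine (hc.trans ?_).trans hρ.2
  exact congrArg (fun T : V →L[ℂ] V => LinearMap.trace ℂ V (T : V →ₗ[ℂ] V)) hU'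

variable [FiniteDimensional ℂ V]

theorem exists_eq_diagOp_of_isPositive (e : OrthonormalBasis (Fin d) ℂ V) {σ : V →L[ℂ] V}
    (hσ : σ.IsPositive) : ∃ (v : OrthonormalBasis (Fin d) ℂ V) (x : Fin d → ℝ), Antitone x ∧
      (∀ i, 0 ≤ x i) ∧ σ = diagOp v fun i => (x i : ℂ) :=
  ⟨_, _, hσ.isSymmetric.eigenvalues_antitone (finrank_eq e),
    hσ.toLinearMap.nonneg_eigenvalues (finrank_eq e),
    exists_eq_diagOp e σ hσ.isSymmetric⟩

theorem isState_passiveRearrangement (e : OrthonormalBasis (Fin d) ℂ V) {ρ : V →L[ℂ] V}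
    (hρ : IsState ρ) : IsState (passiveRearrangement e ρ hρ.isPositive.isSymmetric) := by
  refine ⟨isPositive_diagOp e (hρ.1.toLinearMap.nonneg_eigenvalues (finrank_eq e)), ?_⟩
  have h := hρ.2
  rw [exists_eq_diagOp e ρ hρ.1.isSymmetric, trace_diagOp] at h
  exact (trace_diagOp e _).trans h

/-- The eigenbases of `σ` and `σ'` turn domination into an inequality between sums of eigenvalues:
test domination on the eigenbasis of `σ`, then apply Ky Fan's inequality to `σ'` in the basis `e`. -/
theorem IsMajorizedBy.of_passiveDomination {σ σ' : V →L[ℂ] V}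
    (h : (σ, σ') ∈ passiveDomination e) : IsMajorizedBy σ σ' := by
  obtain ⟨⟨hσ, hσ'⟩, -, hdom⟩ := h
  simp only at hσ hσ' hdom
  refine ⟨hσ, hσ', fun n hn => ?_⟩
  obtain rfl := finrank_eq e
  set hs := hσ.isPositive.isSymmetric
  set hs' := hσ'.isPositive.isSymmetric
  calc ∑ i with i.val < n, hs.eigenvalues rfl i
      = ∑ i with i.val < n, (⟪hs.eigenvectorBasis rfl i, σ (hs.eigenvectorBasis rfl i)⟫_ℂ).re := by
        refine Finset.sum_congr rfl fun i _ => ?_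
        have := hs.apply_eigenvectorBasis rfl i
        rw [ContinuousLinearMap.coe_coe] at this
        rw [this, inner_smul_right, OrthonormalBasis.inner_eq_one, mul_one]
        rfl
    _ ≤ _ := hdom (hs.eigenvectorBasis rfl) n hn
    _ ≤ _ := by
        conv_lhs => rw [exists_eq_diagOp e σ' hs']
        exact sum_inner_diagOp_le e _ (hs'.eigenvalues_antitone _) n

variable [CompleteSpace V] {HLS : V →L[ℂ] V} {L : Fin m → V →L[ℂ] V}

/-- The weight of a positive operator on its `n` highest eigenvectors grows at most at the rate
`r n * x n`, where `x n` is the next eigenvalue; a passive operator attains this rate. The bound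
compares the operator with `x n • 1`, whose image under the generator is passive by concavity of
`r`, and applies Ky Fan's inequality to that image. -/
theorem sum_inner_lindbladian_le (hdiag : ∀ i j, i ≠ j → ⟪e i, HLS (e j)⟫_ℂ = 0)
    (hL : ∀ α, IsDephasing e (L α) ∨ IsOneStepDecay e (L α))
    (hconc : ConcaveUpTo d (jumpRate e L)) (v : OrthonormalBasis (Fin d) ℂ V) {x : Fin d → ℝ}
    (hx : Antitone x) (hx0 : ∀ i, 0 ≤ x i) {y : ℕ → ℝ} (hy : ∀ i : Fin d, y i = x i)
    (hyd : ∀ k, d ≤ k → y k = 0) {n : ℕ} (hn : n ≤ d) :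
    ∑ j : Fin d with j.val < n,
        ∑ k, (x k * transitionRate L v j k - x j * transitionRate L v k j) ≤
      jumpRate e L n * y n := by
  have hc1 : ∀ k : Fin d, k.val < n → y n ≤ x k := by
    intro k hk
    by_cases hnd : n < d
    · exact (hy ⟨n, hnd⟩).trans_le (hx (Fin.le_def.2 hk.le))
    · rw [hyd n (not_lt.1 hnd)]; exact hx0 k
  have hc2 : ∀ k : Fin d, ¬ k.val < n → x k ≤ y n := by
    intro k hk
    have hnd : n < d := (not_lt.1 hk).trans_lt k.2
    exact (hx (Fin.le_def.2 (not_lt.1 hk))).trans_eq (hy ⟨n, hnd⟩).symm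
  have hyn : 0 ≤ y n := by
    by_cases hnd : n < d
    · exact (hx0 ⟨n, hnd⟩).trans_eq (hy ⟨n, hnd⟩).symm
    · rw [hyd n (not_lt.1 hnd)]
  refine (sum_markov_le (transitionRate_nonneg L v) {j : Fin d | j.val < n}
    (fun k hk => hc1 k (by simpa using hk)) (fun k hk => hc2 k (by simpa using hk))).trans ?_
  rw [mul_comm]
  refine mul_le_mul_of_nonneg_right ?_ hyn
  have hone : ∀ j, ∑ k, (transitionRate L v j k - transitionRate L v k j) =
      (⟪v j, diagOp e (fun i => ((jumpRate e L (i + 1) - jumpRate e L i : ℝ) : ℂ)) (v j)⟫_ℂ).re :=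
    fun j => by
      have := re_inner_lindbladian_diagOp_self HLS L v (fun _ => 1) j
      simp only [Complex.ofReal_one, diagOp_one, one_mul] at this
      rw [← this, lindbladian_one hdiag hL]
  simp only [hone]
  refine (sum_inner_diagOp_le v e (antitone_jumpRate_sub_iff.2 hconc) n).trans_eq ?_
  rw [sum_filter_val_lt hn fun i => jumpRate e L (i + 1) - jumpRate e L i]
  simpa using sum_jumpRate_sub (e := e) (L := L) (n := n) fun _ => 1

/-- Domination passes from the right-hand sides of an implicit Euler step to the solutions. With the
eigenvalues `z` of `σ` and the populations `y` of `σ'`, testing domination of the right-hand sides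
on the eigenvectors of `σ` bounds `∑ i < n, z i - h r n z n` by `∑ i < n, y i - h r n y n`. -/
theorem passiveDomination_of_resolvent (hHLS : IsSelfAdjoint HLS)
    (hdiag : ∀ i j, i ≠ j → ⟪e i, HLS (e j)⟫_ℂ = 0)
    (hL : ∀ α, IsDephasing e (L α) ∨ IsOneStepDecay e (L α))
    (hconc : ConcaveUpTo d (jumpRate e L)) {h : ℝ} (hh : 0 ≤ h)
    (hsmall : h * ‖lindbladian HLS L‖ < 1) (hsmall' : h * ∑ α, ‖L α‖ ^ 2 < 1) {σ σ' : V →L[ℂ] V}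
    (hρ : (σ - (h : ℂ) • lindbladian HLS L σ, σ' - (h : ℂ) • lindbladian HLS L σ') ∈
      passiveDomination e) : (σ, σ') ∈ passiveDomination e := by
  obtain ⟨⟨hs, hs'⟩, hpass, hdom⟩ := hρ
  simp only at hs hs' hpass hdom
  have hσ : IsState σ := isState_of_resolvent e hHLS hh hsmall hsmall' hs
  have hσ' : IsState σ' := isState_of_resolvent e hHLS hh hsmall hsmall' hs'
  have hpass' := (isPassive_iff e _).1 hpass
  -- the populations `y` of `σ'`
  obtain ⟨y, hy, hyd⟩ := exists_extend_zero fun i : Fin d => (⟪e i, σ' (e i)⟫_ℂ).re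
  have hσ'y : σ' = diagOp e fun k => (y k : ℂ) := by
    conv_lhs => rw [(eq_diagOp_iff e σ').2 fun i j hij =>
      inner_eq_zero_of_resolvent hdiag hL hh hsmall hpass'.1 hij]
    congr 1
    funext i
    rw [hy i]
    exact (Complex.ext (by simp) (by
      simpa using (RCLike.nonneg_iff.1 (hσ'.1.inner_nonneg_right (e i))).2))
  have hy0 : ∀ k, 0 ≤ y k := by
    intro k
    by_cases hk : k < d
    · exact (hσ'.1.re_inner_nonneg_right (e ⟨k, hk⟩)).trans_eq (hy ⟨k, hk⟩).symm
    · rw [hyd k (not_lt.1 hk)]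
  have hρ'y : ∀ i : Fin d, (⟪e i, (σ' - (h : ℂ) • lindbladian HLS L σ') (e i)⟫_ℂ).re =
      y i - h * (jumpRate e L (i + 1) * y (i + 1) - jumpRate e L i * y i) := by
    intro i
    rw [hσ'y, re_inner_resolvent e (fun k => y k), sum_transitionRate hL]
  have hanti : ∀ i, y (i + 1) ≤ y i := by
    refine le_of_implicit_step_antitone hh (jumpRate_nonneg (e := e) (L := L)) hconc hy0 hyd
      fun i hi => ?_
    have := hpass'.2.2 ⟨i, by omega⟩ ⟨i + 1, hi⟩ (Fin.le_def.2 (by simp))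
    rwa [hρ'y, hρ'y] at this
  have hyanti : Antitone y := antitone_nat_of_succ_le hanti
  -- the eigenvalues `x` of `σ`
  obtain ⟨v, x, hx, hx0, hσx⟩ := exists_eq_diagOp_of_isPositive e hσ.1
  obtain ⟨z, hz, hzd⟩ := exists_extend_zero x
  have hsums := sum_range_le_of_implicit_step (d := d) (x := z) (y := y) hh
    (jumpRate_nonneg (e := e) (L := L)) (jumpRate_of_le le_rfl) (fun n hn => by
      have h1 := hdom v n hn
      simp only [hρ'y] at h1
      rw [hσx] at h1
      simp only [re_inner_resolvent] at h1
      rw [Finset.sum_sub_distrib, ← Finset.mul_sum] at h1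
      have h2 := mul_le_mul_of_nonneg_left
        (sum_inner_lindbladian_le hdiag hL hconc v hx hx0 hz hzd hn) hh
      rw [sum_filter_val_lt hn fun i =>
          y i - h * (jumpRate e L (i + 1) * y (i + 1) - jumpRate e L i * y i),
        Finset.sum_sub_distrib, ← Finset.mul_sum, sum_jumpRate_sub] at h1
      have h3 : ∑ j : Fin d with j.val < n, x j = ∑ i ∈ Finset.range n, z i := by
        rw [← sum_filter_val_lt hn z]
        exact Finset.sum_congr rfl fun j _ => (hz j).symm
      linarith)
  refine ⟨⟨hσ, hσ'⟩, ⟨fun i => y i, fun i j hij => hyanti hij, hσ'y⟩, fun u n hn => ?_⟩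
  simp only
  calc ∑ j : Fin d with j.val < n, (⟪u j, σ (u j)⟫_ℂ).re
      ≤ ∑ k : Fin d with k.val < n, x k := by rw [hσx]; exact sum_inner_diagOp_le u v hx n
    _ = ∑ i ∈ Finset.range n, z i := by
        rw [← sum_filter_val_lt hn z]
        exact Finset.sum_congr rfl fun j _ => (hz j).symm
    _ ≤ ∑ i ∈ Finset.range n, y i := hsums n hn
    _ = ∑ j : Fin d with j.val < n, (⟪e j, σ' (e j)⟫_ℂ).re := by
        rw [← sum_filter_val_lt hn y]
        exact Finset.sum_congr rfl fun j _ => hy j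

theorem passiveDomination_evolution (hHLS : IsSelfAdjoint HLS)
    (hdiag : ∀ i j, i ≠ j → ⟪e i, HLS (e j)⟫_ℂ = 0)
    (hL : ∀ α, IsDephasing e (L α) ∨ IsOneStepDecay e (L α))
    (hconc : ConcaveUpTo d (jumpRate e L)) {t : ℝ} (ht : 0 ≤ t) {ρ ρ' : V →L[ℂ] V}
    (hρ : (ρ, ρ') ∈ passiveDomination e) :
    (evolution (lindbladian HLS L) t ρ, evolution (lindbladian HLS L) t ρ') ∈
      passiveDomination e := by
  have hb : 0 ≤ ∑ α, ‖L α‖ ^ 2 := Finset.sum_nonneg fun α _ => by positivity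
  -- for `h < C⁻¹` both `h ‖ℒ‖` and `h ∑ α, ‖L α‖²` are below one
  set C := ‖lindbladian HLS L‖ + ∑ α, ‖L α‖ ^ 2 + 1 with hC
  have hCpos : 0 < C := by positivity
  refine evolution_rel_of_resolvent _ (isClosed_passiveDomination e) (inv_pos.2 hCpos)
    (fun h hh hlt σ σ' hmem => ?_) ht hρ
  have hhC : h * C < 1 := by rwa [← lt_inv_mul_iff₀' hCpos, mul_one]
  have h1 := mul_nonneg hh (norm_nonneg (lindbladian HLS L))
  have h2 := mul_nonneg hh hb
  have h3 : h * C = h * ‖lindbladian HLS L‖ + h * ∑ α, ‖L α‖ ^ 2 + h := by rw [hC]; ring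
  exact passiveDomination_of_resolvent hHLS hdiag hL hconc hh (by linarith) (by linarith) hmem

theorem conj_unitary_mem_passiveDomination (e : OrthonormalBasis (Fin d) ℂ V) {ρ : V →L[ℂ] V}
    (hρ : IsState ρ) {U : V →L[ℂ] V} (hU : U ∈ unitary (V →L[ℂ] V)) :
    (U * ρ * star U, passiveRearrangement e ρ hρ.isPositive.isSymmetric) ∈
      passiveDomination e := by
  have hanti := hρ.1.isSymmetric.eigenvalues_antitone (finrank_eq e)
  refine ⟨⟨isState_conj_unitary hρ hU, isState_passiveRearrangement e hρ⟩, ⟨_, hanti, rfl⟩,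
    fun u n _ => ?_⟩
  -- the expectation of `U ρ U†` in `u` is that of `ρ` in the orthonormal basis `U† u`
  let W := Unitary.linearIsometryEquiv (⟨star U, Unitary.star_mem hU⟩ : unitary (V →L[ℂ] V))
  have hW : ∀ w, W w = star U w := fun w => rfl
  have h1 : ∀ j, ⟪u j, (U * ρ * star U) (u j)⟫_ℂ = ⟪u.map W j, ρ (u.map W j)⟫_ℂ := fun j => by
    rw [OrthonormalBasis.map_apply, hW, mul_apply_eq_comp, mul_apply_eq_comp,
      ContinuousLinearMap.star_eq_adjoint, ContinuousLinearMap.adjoint_inner_left]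
  have h2 : ∀ j, (⟪e j, passiveRearrangement e ρ hρ.isPositive.isSymmetric (e j)⟫_ℂ).re =
      hρ.1.isSymmetric.eigenvalues (finrank_eq e) j := fun j => by
    rw [passiveRearrangement, inner_diagOp, e.inner_eq_one, mul_one, Complex.ofReal_re]
  simp only [h1, h2]
  conv_lhs => rw [exists_eq_diagOp e ρ hρ.1.isSymmetric]
  exact sum_inner_diagOp_le (u.map W) _ hanti n

end Domination

end LossyChannel

theorem mainTheorem1 {V : Type*} [NormedAddCommGroup V] [InnerProductSpace ℂ V]
    [FiniteDimensional ℂ V] [CompleteSpace V] {d m : ℕ}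
    -- non-degenerate Hamiltonian with energy eigenbasis `e`
    (e : OrthonormalBasis (Fin d) ℂ V) (E : Fin d → ℝ) (hE : StrictMono E)
    (H : V →L[ℂ] V) (hH : ∀ i, H (e i) = (E i : ℂ) • e i)
    -- Lamb-shift term and Lindblad operators
    (HLS : V →L[ℂ] V) (hHLS : IsSelfAdjoint HLS) (hcomm : Commute HLS H)
    (L : Fin m → V →L[ℂ] V)
    (hL : ∀ α, LossyChannel.IsDephasing e (L α) ∨ LossyChannel.IsOneStepDecay e (L α)) :
    (LossyChannel.IsPassive e (LossyChannel.lindbladian HLS L 1) ↔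
      LossyChannel.ConcaveUpTo d (LossyChannel.jumpRate e L)) ∧
    (LossyChannel.ConcaveUpTo d (LossyChannel.jumpRate e L) →
      (∀ (ρ : V →L[ℂ] V) (hρ : LossyChannel.IsState ρ) (t : ℝ), 0 ≤ t →
        LossyChannel.IsMajorizedBy
          (LossyChannel.evolution (LossyChannel.lindbladian HLS L) t ρ)
          (LossyChannel.evolution (LossyChannel.lindbladian HLS L) t
            (LossyChannel.passiveRearrangement e ρ hρ.isPositive.isSymmetric)) ∧
        ∀ U ∈ unitary (V →L[ℂ] V),
          LossyChannel.IsMajorizedBy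
            (LossyChannel.evolution (LossyChannel.lindbladian HLS L) t (U * ρ * star U))
            (LossyChannel.evolution (LossyChannel.lindbladian HLS L) t
              (LossyChannel.passiveRearrangement e ρ hρ.isPositive.isSymmetric))) ∧
      (∀ (ρ : V →L[ℂ] V), LossyChannel.IsState ρ → LossyChannel.IsPassive e ρ →
        ∀ t : ℝ, 0 ≤ t →
          LossyChannel.IsState (LossyChannel.evolution (LossyChannel.lindbladian HLS L) t ρ) ∧
          LossyChannel.IsPassive e
            (LossyChannel.evolution (LossyChannel.lindbladian HLS L) t ρ))) := by
  have hdiag : ∀ i j, i ≠ j → inner ℂ (e i) (HLS (e j)) = 0 := fun i j hij =>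
    LossyChannel.inner_eq_zero_of_commute hE hH hcomm hij
  refine ⟨LossyChannel.isPassive_lindbladian_one_iff hdiag hL, fun hconc =>
    ⟨fun ρ hρ t ht => ?_, fun ρ hρ hp t ht => ?_⟩⟩
  · have key : ∀ U ∈ unitary (V →L[ℂ] V), LossyChannel.IsMajorizedBy
        (LossyChannel.evolution (LossyChannel.lindbladian HLS L) t (U * ρ * star U))
        (LossyChannel.evolution (LossyChannel.lindbladian HLS L) t
          (LossyChannel.passiveRearrangement e ρ hρ.isPositive.isSymmetric)) := fun U hU =>
      LossyChannel.IsMajorizedBy.of_passiveDomination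
        (LossyChannel.passiveDomination_evolution hHLS hdiag hL hconc ht
          (LossyChannel.conj_unitary_mem_passiveDomination e hρ hU))
    refine ⟨?_, key⟩
    simpa using key 1 (one_mem _)
  · have h := LossyChannel.passiveDomination_evolution hHLS hdiag hL hconc ht
      (LossyChannel.self_mem_passiveDomination hρ hp)
    exact ⟨h.1.1, h.2.1⟩
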